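/- For a positive integer $\ell$ and an integer $n\ge 0$, let $b_\ell(n)$ denote the number of $\ell$-regular partitions of $n$, i.e. partitions of $n$ none of whose parts is divisible by $\ell$ (so $b_\ell(0)=1$), and set $b_\ell(n)=0$ for $n<0$. Let $\alpha,n$ be nonnegative integers and let $p_1,\dots,p_{\alpha+1}$ be primes (not necessarily distinct) such that $b_{25}(p_i-1)\equiv 0\pmod 5$ for every $1\le i\le\alpha+1$. Then for every integer $j\not\equiv 0\pmod{p_{\alpha+1}}$, $$b_{25}\left(p_1^2\cdots p_{\alpha+1}^2\,n+p_1^2\cdots p_{\alpha}^2\,p_{\alpha+1}(j+p_{\alpha+1})-1\right)\equiv 0\pmod 5,$$ where for $\alpha=0$ the empty product $p_1^2\cdots p_\alpha^2$ equals $1$. -/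

import Mathlib

/-- The number `b_ℓ(n)` of `ℓ`-regular partitions of `n`, i.e. partitions of `n` none of whose
parts is divisible by `ℓ`; it is `0` for negative `n`. -/
def regularPartitionCount (ℓ : ℕ) (n : ℤ) : ℕ :=
  if 0 ≤ n then (Nat.Partition.restricted n.toNat (fun i => ¬ ℓ ∣ i)).card else 0

/-! ### Euler products modulo a prime -/

section FormalProducts
open PowerSeries

/-! Everything rests on the congruence b₂₅(N-1) ≡ N σ(N) (mod 5),
`natCast_regularPartitionCount_twentyFive`. By Frobenius, ∏ (1-X^(25i))/(1-X^i) ≡ ∏ (1-X^i)^24, so X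
times the generating function of b₂₅ is Δ mod 5. The identity 2E₄θE₆ - 3E₆θE₄ = -1728Δ (θ = q d/dq)
reduces mod 5 to Δ ≡ ∑ m σ₅(m) X^m, and σ₅ ≡ σ₁ by Fermat. For a prime q the hypothesis thus reads 5
∣ q(q+1). The argument plus one is N = P²qM with q ∤ M, so q divides N to an odd power, whence q+1 ∣
σ(N) and 5 ∣ N σ(N). -/

theorem geom_sum_one_sub_pow_char_pow {R : Type*} [CommRing R] [IsDomain R] (p k : ℕ)
    [Fact p.Prime] [CharP R p] {y : R} (hy : y ≠ 1) :
    ∑ j ∈ Finset.range (p ^ k), y ^ j = (1 - y) ^ (p ^ k - 1) := by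
  refine mul_right_cancel₀ (sub_ne_zero.mpr hy.symm) ?_
  rw [geom_sum_mul_neg, ← pow_succ, Nat.sub_add_cancel (Nat.pow_pos (Fact.out : p.Prime).pos),
    sub_pow_char_pow, one_pow]

/-- Glaisher: regular partitions are equinumerous with those repeating each part fewer than `p ^ k`
times. Each factor of that product is a geometric sum, which Frobenius turns into a power of `1 - X
^ (i + 1)`. -/
theorem mk_card_restricted_eq_pentagonalSeries_pow (p k : ℕ) [Fact p.Prime] :
    PowerSeries.mk (fun n ↦ ((Nat.Partition.restricted n (fun i => ¬ p ^ k ∣ i)).card : ZMod p)) =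
      pentagonalSeries (ZMod p) ^ (p ^ k - 1) := by
  have hpos : 0 < p ^ k := Nat.pow_pos (Fact.out : p.Prime).pos
  let _ : TopologicalSpace (ZMod p) := ⊥
  have _ : DiscreteTopology (ZMod p) := ⟨rfl⟩
  simp_rw [Nat.Partition.card_restricted_eq_card_countRestricted _ hpos]
  have h₁ := Nat.Partition.hasProd_powerSeriesMk_card_countRestricted (ZMod p) hpos
  open scoped PowerSeries.WithPiTopology in
  have h₂ := (WithPiTopology.hasProd_one_sub_X_pow (ZMod p)).map
    (powMonoidHom (p ^ k - 1) : (ZMod p)⟦X⟧ →* (ZMod p)⟦X⟧) (continuous_pow _)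
  have : CharP (ZMod p)⟦X⟧ p := charP_of_injective_algebraMap
    (R := ZMod p) (A := (ZMod p)⟦X⟧) (C_injective) p
  have hfun : (fun i ↦ ∑ j ∈ Finset.range (p ^ k), (X : (ZMod p)⟦X⟧) ^ ((i + 1) * j)) =
      powMonoidHom (p ^ k - 1) ∘ fun n ↦ 1 - X ^ (n + 1) := by
    ext1 i
    simp only [pow_mul, Function.comp_apply, powMonoidHom_apply]
    refine geom_sum_one_sub_pow_char_pow p k fun h ↦ ?_
    simpa using congrArg (constantCoeff (R := ZMod p)) h
  rw [hfun] at h₁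
  exact h₁.unique h₂

end FormalProducts

/-- The sum of the divisors of an integer is divisible by `p + 1` if the exponent of the prime `p` in it
is odd. -/
theorem add_one_dvd_sigma_one_of_odd_factorization {p N : ℕ} (hp : p.Prime) (hN : N ≠ 0)
    (h : Odd (N.factorization p)) : p + 1 ∣ ArithmeticFunction.sigma 1 N := by
  obtain ⟨k, hk⟩ := h
  have hcop : (p ^ N.factorization p).Coprime (N / p ^ N.factorization p) :=
    Nat.Coprime.pow_left _ (Nat.coprime_ordCompl hp hN)
  rw [← Nat.ordProj_mul_ordCompl_eq_self N p,
    ArithmeticFunction.isMultiplicative_sigma.map_mul_of_coprime hcop]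
  refine Dvd.dvd.mul_right ?_ _
  rw [hk, ArithmeticFunction.sigma_one_apply_prime_pow hp,
    show 2 * k + 1 + 1 = 2 * (k + 1) by ring]
  refine ⟨∑ i ∈ Finset.range (k + 1), p ^ (2 * i), ?_⟩
  -- The divisor sum pairs up as p^(2i) + p^(2i+1) = p^(2i) (p + 1).
  induction k + 1 with
  | zero => simp
  | succ m ih => rw [show 2 * (m + 1) = 2 * m + 1 + 1 by ring, Finset.sum_range_succ,
      Finset.sum_range_succ, ih, Finset.sum_range_succ]; ring

/-! ### The q-expansion of Δ as a formal product -/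

section DiscriminantExpansion
open PowerSeries Filter Topology

theorem TendstoLocallyUniformlyOn.iteratedDeriv_and_differentiableOn {ι : Type*}
    {φ : Filter ι} [φ.NeBot] {U : Set ℂ} {F : ι → ℂ → ℂ} {f : ℂ → ℂ}
    (hf : TendstoLocallyUniformlyOn F f φ U) (hU : IsOpen U)
    (hF : ∀ᶠ n in φ, DifferentiableOn ℂ (F n) U) (m : ℕ) :
    TendstoLocallyUniformlyOn (fun n ↦ iteratedDeriv m (F n)) (iteratedDeriv m f) φ U ∧
      ∀ᶠ n in φ, DifferentiableOn ℂ (iteratedDeriv m (F n)) U := by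
  induction m with
  | zero => simpa using ⟨hf, hF⟩
  | succ m ih =>
    simp only [iteratedDeriv_succ]
    exact ⟨ih.1.deriv ih.2 hU, ih.2.mono fun n hn ↦ hn.deriv hU⟩

/-- The formal Taylor series at `0` of a function of a complex variable. -/
noncomputable def taylorPowerSeries (F : ℂ → ℂ) : ℂ⟦X⟧ :=
  .mk fun m ↦ (m.factorial : ℂ)⁻¹ * iteratedDeriv m F 0

theorem taylorPowerSeries_mul {F G : ℂ → ℂ} (hF : AnalyticAt ℂ F 0) (hG : AnalyticAt ℂ G 0) :
    taylorPowerSeries (F * G) = taylorPowerSeries F * taylorPowerSeries G := by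
  ext
  simp only [taylorPowerSeries, coeff_mk, iteratedDeriv_mul hF.contDiffAt hG.contDiffAt,
    Finset.mul_sum, PowerSeries.coeff_mul, Finset.Nat.sum_antidiagonal_eq_sum_range_succ_mk,
    Nat.succ_eq_add_one]
  refine Finset.sum_congr rfl fun i hi ↦ ?_
  rw [Nat.cast_choose _ (by grind)]
  field_simp [Nat.factorial_ne_zero]

theorem Polynomial.iteratedDeriv_eval (P : Polynomial ℂ) (m : ℕ) :
    iteratedDeriv m (fun z ↦ P.eval z) = fun z ↦ (derivative^[m] P).eval z := by
  induction m with
  | zero => simp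
  | succ m ih =>
    rw [iteratedDeriv_succ, ih, Function.iterate_succ_apply']
    ext z
    exact Polynomial.deriv _

theorem taylorPowerSeries_eval (P : Polynomial ℂ) :
    taylorPowerSeries (fun z ↦ P.eval z) = P := by
  ext m
  rw [taylorPowerSeries, coeff_mk, Polynomial.coeff_coe, Polynomial.iteratedDeriv_eval]
  beta_reduce
  rw [← Polynomial.coeff_zero_eq_eval_zero, Polynomial.coeff_iterate_derivative]
  simp [Nat.descFactorial_self, Nat.factorial_ne_zero]

/-- Locally uniform convergence carries Taylor coefficients to the limit, while the coefficients of
the formal partial products are eventually constant. -/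
theorem taylorPowerSeries_tprod_one_sub_pow :
    taylorPowerSeries (fun q ↦ ∏' n : ℕ, (1 - q ^ (n + 1))) = pentagonalSeries ℂ := by
  have h := ModularForm.multipliableLocallyUniformlyOn_one_sub_pow.hasProdLocallyUniformlyOn
  ext m
  have h₁ := ((h.iteratedDeriv_and_differentiableOn Metric.isOpen_ball (.of_forall fun s ↦ by
    simpa [Finset.prod_fn] using DifferentiableOn.finsetProd (fun _ _ ↦ by fun_prop))
    m).1.tendsto_at (Metric.mem_ball_self one_pos)).const_mul ((m.factorial : ℂ)⁻¹)
  have h₂ := coeff_prod_one_sub_X_pow_eventually_eq ℂ m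
  rw [taylorPowerSeries, coeff_mk]
  refine tendsto_nhds_unique h₁ (tendsto_const_nhds.congr' ?_)
  filter_upwards [h₂] with s hs
  rw [← hs]
  have := congrArg (coeff m)
    (taylorPowerSeries_eval (∏ n ∈ s, (1 - (Polynomial.X : Polynomial ℂ) ^ (n + 1))))
  rw [← Polynomial.coeToPowerSeries.ringHom_apply, map_prod] at this
  simpa [taylorPowerSeries, Polynomial.eval_prod] using this.symm

theorem qExpansion_discriminant :
    UpperHalfPlane.qExpansion 1 ModularForm.discriminant = X * pentagonalSeries ℂ ^ 24 := by
  have han : AnalyticAt ℂ (fun q : ℂ ↦ ∏' n : ℕ, (1 - q ^ (n + 1))) 0 :=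
    ModularForm.differentiableOn_tprod_one_sub_pow.analyticAt (Metric.ball_mem_nhds _ one_pos)
  have hpow (k : ℕ) : taylorPowerSeries ((fun q : ℂ ↦ ∏' n : ℕ, (1 - q ^ (n + 1))) ^ k) =
      pentagonalSeries ℂ ^ k := by
    induction k with
    | zero => simpa [Pi.one_def] using taylorPowerSeries_eval 1
    | succ k ih =>
      rw [pow_succ, pow_succ, taylorPowerSeries_mul (han.pow k) han, ih,
        taylorPowerSeries_tprod_one_sub_pow]
  have hX : taylorPowerSeries id = X := by
    simpa [Function.id_def] using taylorPowerSeries_eval Polynomial.X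
  rw [← hX, ← hpow, ← taylorPowerSeries_mul analyticAt_id (han.pow 24)]
  ext m
  rw [UpperHalfPlane.qExpansion_coeff, taylorPowerSeries, coeff_mk]
  congr 1
  refine Filter.EventuallyEq.iteratedDeriv_eq m ?_
  filter_upwards [Metric.ball_mem_nhds (0 : ℂ) one_pos] with q hq
  rw [ModularForm.discriminant_cuspFunction_eqOn hq]
  beta_reduce
  rw [(ModularForm.multipliable_one_sub_pow (by simpa using hq)).tprod_pow 24]
  rfl

end DiscriminantExpansion

/-! ### Δ as a bracket of Eisenstein series -/

section EisensteinBracket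
open PowerSeries Filter Topology
open UpperHalfPlane hiding I
open Complex ModularForm Derivative Function
open scoped Manifold MatrixGroups

theorem periodic_comp_ofComplex_of_hasSum {f : ℍ → ℂ} {c : ℕ → ℂ}
    (hf : ∀ τ : ℍ, HasSum (fun m ↦ c m • Periodic.qParam 1 τ ^ m) (f τ)) :
    Periodic (f ∘ ofComplex) (1 : ℝ) := by
  intro w
  by_cases hw : 0 < im w
  · have hw' : 0 < im (w + (1 : ℝ)) := by simp [hw]
    simp only [comp_apply, ofComplex_apply_of_im_pos hw', ofComplex_apply_of_im_pos hw]
    refine (hf _).unique ?_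
    convert hf ⟨w, hw⟩ using 4
    simp [Periodic.qParam, mul_add, Complex.exp_add]
  · have hw' : im (w + (1 : ℝ)) ≤ 0 := by simpa using hw
    -- Off the upper half-plane `ofComplex` takes a constant default value.
    rw [comp_apply, comp_apply, ofComplex_apply_of_im_nonpos hw',
      ofComplex_apply_of_im_nonpos (not_lt.mp hw)]

theorem analyticAt_cuspFunction_of_hasSum {f : ℍ → ℂ} {c : ℕ → ℂ} (hd : MDiff f)
    (hf : ∀ τ : ℍ, HasSum (fun m ↦ c m • Periodic.qParam 1 τ ^ m) (f τ)) :
    AnalyticAt ℂ (cuspFunction 1 f) 0 :=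
  analyticAt_cuspFunction_zero one_pos (periodic_comp_ofComplex_of_hasSum hf) hd
    (isBoundedAtImInfty_of_hasSum_qExpansion one_pos hf)

theorem qExpansion_eq_mk_of_hasSum {f : ℍ → ℂ} {c : ℕ → ℂ} (hd : MDiff f)
    (hf : ∀ τ : ℍ, HasSum (fun m ↦ c m • Periodic.qParam 1 τ ^ m) (f τ)) :
    qExpansion 1 f = .mk c := by
  ext m
  have han := analyticAt_cuspFunction_of_hasSum hd hf
  have h := (hasFPowerSeriesOnBall_cuspFunction one_pos han hf).hasFPowerSeriesAt
  have := congrArg (FormalMultilinearSeries.coeff · m)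
    (han.hasFPowerSeriesAt.eq_formalMultilinearSeries h)
  simpa [qExpansion_coeff, div_eq_mul_inv, mul_comm] using this

section LevelOne
variable {k : ℤ} (f : ModularForm 𝒮ℒ k)

/-- Termwise differentiation of the `q`-expansion of a level one form. -/
theorem hasSum_normalizedDerivOfComplex (τ : ℍ) :
    HasSum (fun m : ℕ ↦ ((m : ℂ) * (qExpansion 1 f).coeff m) • Periodic.qParam 1 τ ^ m)
      (normalizedDerivOfComplex f τ) := by
  set F := cuspFunction 1 f with hFdef
  have hF (q : ℂ) (hq : ‖q‖ < 1) : DifferentiableAt ℂ F q :=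
    ModularFormClass.differentiableAt_cuspFunction f one_pos one_mem_strictPeriods_SL hq
  have hF' : DifferentiableOn ℂ (deriv F) (Metric.ball 0 1) :=
    DifferentiableOn.deriv (fun q hq ↦ (hF q (by simpa using hq)).differentiableWithinAt)
      Metric.isOpen_ball
  have hq : ‖Periodic.qParam 1 (τ : ℂ)‖ < 1 := Periodic.norm_qParam_lt_one one_pos τ.im_pos
  have hval : normalizedDerivOfComplex f τ =
      Periodic.qParam 1 τ * deriv F (Periodic.qParam 1 τ) := by
    have heq : (f ∘ ofComplex) =ᶠ[𝓝 (τ : ℂ)] F ∘ Periodic.qParam 1 := by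
      filter_upwards [isOpen_upperHalfPlaneSet.mem_nhds τ.im_pos] with w hw
      have := SlashInvariantFormClass.eq_cuspFunction f ⟨w, hw⟩ one_mem_strictPeriods_SL one_ne_zero
      rw [comp_apply, ofComplex_apply_of_im_pos hw, comp_apply, ← this]
    have hqd : HasDerivAt (Periodic.qParam 1) (Periodic.qParam 1 τ * (2 * Real.pi * I))
        (τ : ℂ) := by
      have : HasDerivAt (fun z : ℂ ↦ 2 * Real.pi * I * z / (1 : ℝ)) (2 * Real.pi * I) (τ : ℂ) := by
        simpa using (hasDerivAt_id (τ : ℂ)).const_mul (2 * Real.pi * I)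
      exact this.cexp
    rw [normalizedDerivOfComplex, heq.deriv_eq,
      ((hF _ hq).hasDerivAt.comp (τ : ℂ) hqd).deriv]
    have := two_pi_I_ne_zero
    field_simp
  have hs := (hasSum_taylorSeries_on_ball hF' (z := Periodic.qParam 1 (τ : ℂ))
    (by simpa using hq)).mul_left (Periodic.qParam 1 (τ : ℂ))
  rw [hval, ← hasSum_nat_add_iff' 1]
  simp only [Finset.range_one, Finset.sum_singleton, Nat.cast_zero, zero_mul, zero_smul, sub_zero]
  refine hs.congr_fun fun m ↦ ?_
  rw [qExpansion_coeff, ← hFdef, iteratedDeriv_succ', Nat.factorial_succ]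
  have := Nat.factorial_ne_zero m
  have : (m : ℂ) + 1 ≠ 0 := by exact_mod_cast m.succ_ne_zero
  push_cast
  simp only [smul_eq_mul, sub_zero]
  field_simp
  ring

/-- The Serre derivative of a level one modular form. -/
noncomputable def serreDerivativeForm : ModularForm 𝒮ℒ (k + 2) where
  toFun := serreDerivative k f
  slash_action_eq' A hA := by
    obtain ⟨γ, rfl⟩ := hA
    exact serreDerivative_slash_invariant f.holo' (f.slash_action_eq' _ ⟨γ, rfl⟩)
  holo' := serreDerivative_mdifferentiable _ f.holo'
  bdd_at_cusps' {c} hc := by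
    rw [Subgroup.IsArithmetic.isCusp_iff_isCusp_SL2Z] at hc
    rw [OnePoint.isBoundedAt_iff_forall_SL2Z hc]
    intro γ _
    have : serreDerivative k f ∣[k + 2] γ = serreDerivative k f :=
      serreDerivative_slash_invariant f.holo' (f.slash_action_eq' _ ⟨γ, rfl⟩)
    rw [this]
    have h₁ := isBoundedAtImInfty_of_hasSum_qExpansion one_pos (hasSum_normalizedDerivOfComplex f)
    have h₂ : IsBoundedAtImInfty f := ModularFormClass.bdd_at_infty f
    exact h₁.sub (((EisensteinSeries.isBoundedAtImInfty_E2.const_mul_left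
      (k * 12⁻¹ : ℂ)).mul h₂).congr_right (by simp))

theorem qExpansion_serreDerivativeForm :
    qExpansion 1 (serreDerivativeForm f) =
      .mk (fun m ↦ (m : ℂ) * (qExpansion 1 f).coeff m) -
        (k * 12⁻¹ : ℂ) • (qExpansion 1 EisensteinSeries.E2 * qExpansion 1 f) := by
  have hD : MDiff (normalizedDerivOfComplex f) :=
    normalizedDerivOfComplex_mdifferentiable f.holo'
  have hDs := hasSum_normalizedDerivOfComplex f
  have hE : AnalyticAt ℂ (cuspFunction 1 EisensteinSeries.E2) 0 :=
    analyticAt_cuspFunction_of_hasSum E2_mdifferentiable fun τ ↦ by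
      simpa only [Periodic.qParam, ofReal_one, div_one] using
        EisensteinSeries.hasSum_qExpansion_E2 (z := τ)
  have hf := ModularFormClass.analyticAt_cuspFunction_zero f one_pos one_mem_strictPeriods_SL
  have hEf : AnalyticAt ℂ (cuspFunction 1 (EisensteinSeries.E2 * ⇑f)) 0 := by
    rw [cuspFunction_mul hE.continuousAt hf.continuousAt]
    exact hE.mul hf
  have hEf' : AnalyticAt ℂ (cuspFunction 1 ((k * 12⁻¹ : ℂ) • (EisensteinSeries.E2 * ⇑f))) 0 := by
    rw [cuspFunction_smul hEf.continuousAt]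
    exact hEf.const_smul
  have hcoe : ⇑(serreDerivativeForm f) = normalizedDerivOfComplex f -
      (k * 12⁻¹ : ℂ) • (EisensteinSeries.E2 * ⇑f) := by
    ext z
    change normalizedDerivOfComplex f z - k * 12⁻¹ * EisensteinSeries.E2 z * f z = _
    simp [mul_assoc]
  rw [hcoe, qExpansion_sub (analyticAt_cuspFunction_of_hasSum hD hDs) hEf', qExpansion_smul hEf,
    qExpansion_mul hE hf, qExpansion_eq_mk_of_hasSum hD hDs]

end LevelOne

/-- The combination `2 E₄ ∂E₆ - 3 E₆ ∂E₄`, proportional to the first Rankin-Cohen bracket. -/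
noncomputable def bracketE₄E₆ : ModularForm 𝒮ℒ 12 :=
  (2 : ℂ) • ModularForm.mcast (by norm_num) (E₄.mul (serreDerivativeForm E₆)) -
    (3 : ℂ) • ModularForm.mcast (by norm_num) (E₆.mul (serreDerivativeForm E₄))

/-- The E₂ terms of the two Serre derivatives cancel, since 2 · 6 = 3 · 4. -/
theorem qExpansion_bracketE₄E₆ :
    qExpansion 1 bracketE₄E₆ =
      2 * qExpansion 1 E₄ * .mk (fun m ↦ (m : ℂ) * (qExpansion 1 E₆).coeff m) -
      3 * qExpansion 1 E₆ * .mk (fun m ↦ (m : ℂ) * (qExpansion 1 E₄).coeff m) := by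
  have h : ⇑bracketE₄E₆ = ⇑((2 : ℂ) • E₄.mul (serreDerivativeForm E₆)) -
      ⇑((3 : ℂ) • E₆.mul (serreDerivativeForm E₄)) := rfl
  rw [h, ModularForm.qExpansion_sub one_pos one_mem_strictPeriods_SL, FunLike.coe_smul,
    FunLike.coe_smul, ModularForm.qExpansion_smul one_pos one_mem_strictPeriods_SL,
    ModularForm.qExpansion_smul one_pos one_mem_strictPeriods_SL,
    ModularForm.qExpansion_mul one_pos one_mem_strictPeriods_SL,
    ModularForm.qExpansion_mul one_pos one_mem_strictPeriods_SL,
    qExpansion_serreDerivativeForm, qExpansion_serreDerivativeForm]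
  simp only [smul_eq_C_mul]
  have h2 : (C (2 : ℂ) : ℂ⟦X⟧) = 2 := map_ofNat _ 2
  have h3 : (C (3 : ℂ) : ℂ⟦X⟧) = 3 := map_ofNat _ 3
  have h6 : (2 : ℂ⟦X⟧) * C (((6 : ℤ) : ℂ) * 12⁻¹) = 1 := by
    rw [← h2, ← map_mul]; norm_num
  have h4 : (3 : ℂ⟦X⟧) * C (((4 : ℤ) : ℂ) * 12⁻¹) = 1 := by
    rw [← h3, ← map_mul]; norm_num
  rw [h2, h3]
  push_cast at h4 h6 ⊢
  linear_combination (qExpansion 1 E₄ * qExpansion 1 E₆ * qExpansion 1 EisensteinSeries.E2) *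
    (h4 - h6)

/-- Weight 12 cusp forms are multiples of Δ; the coefficient of q, 2 · (-504) - 3 · 240, fixes the
scalar. -/
theorem qExpansion_bracketE₄E₆_eq_smul_discriminant :
    qExpansion 1 bracketE₄E₆ = (-1728 : ℂ) • qExpansion 1 discriminant := by
  have h0 : (qExpansion 1 bracketE₄E₆).coeff 0 = 0 := by
    rw [qExpansion_bracketE₄E₆]
    simp
  have h1 : (qExpansion 1 bracketE₄E₆).coeff 1 = -1728 := by
    rw [qExpansion_bracketE₄E₆]
    have h2 : (2 : ℂ⟦X⟧) = C (2 : ℂ) := (map_ofNat _ 2).symm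
    have h3 : (3 : ℂ⟦X⟧) = C (3 : ℂ) := (map_ofNat _ 3).symm
    rw [h2, h3, mul_assoc, mul_assoc, map_sub, coeff_C_mul, coeff_C_mul]
    norm_num [coeff_mul, Finset.Nat.antidiagonal_succ, E₄_qExpansion_coeff_one,
      E₆_qExpansion_coeff_one, EisensteinSeries.E_qExpansion_coeff_zero _ ⟨2, rfl⟩,
      EisensteinSeries.E_qExpansion_coeff_zero _ ⟨3, rfl⟩]
  obtain ⟨g, hg⟩ := (isCuspForm_iff_coeffZero_eq_zero _).mpr h0
  obtain ⟨c, hc⟩ := CuspForm.exists_smul_discriminant_of_weight_eq_twelve g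
  have hgE : (g : ℍ → ℂ) = bracketE₄E₆ := congrArg DFunLike.coe hg
  have hcΔ : (c • CuspForm.discriminant : ℍ → ℂ) = g := congrArg DFunLike.coe hc
  have hgΔ := ModularForm.qExpansion_smul one_pos one_mem_strictPeriods_SL c CuspForm.discriminant
  rw [hcΔ, hgE] at hgΔ
  have hc_eq : c = -1728 := by
    simpa [PowerSeries.coeff_smul, discriminant_qExpansion_coeff_one, h1] using
      (congr_arg (·.coeff 1) hgΔ).symm
  rw [hgΔ, hc_eq, CuspForm.coe_discriminant]

end EisensteinBracket

/-! ### Reduction modulo 5 -/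

section TauCongruence
open PowerSeries
open scoped ArithmeticFunction.sigma

theorem map_pentagonalSeries {R S : Type*} [CommRing R] [CommRing S] (φ : R →+* S) :
    (pentagonalSeries R).map φ = pentagonalSeries S := by
  ext n
  rw [coeff_map]
  by_cases h : n ∈ Set.range pentagonal
  · obtain ⟨k, rfl⟩ := h
    simp
  · simp [coeff_pentagonalSeries_eq_zero _ h]

/-- The series `∑ n * σ_k(n) X^n`. -/
def derivSigmaSeries (R : Type*) [CommRing R] (k : ℕ) : R⟦X⟧ := .mk fun m ↦ (m * σ k m : R)

/-- The series `∑ σ_k(n) X^n`. -/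
def sigmaSeries (R : Type*) [CommRing R] (k : ℕ) : R⟦X⟧ := .mk fun m ↦ (σ k m : R)

theorem map_sigmaSeries {R S : Type*} [CommRing R] [CommRing S] (φ : R →+* S) (k : ℕ) :
    (sigmaSeries R k).map φ = sigmaSeries S k := by
  ext n; simp [sigmaSeries]

theorem map_derivSigmaSeries {R S : Type*} [CommRing R] [CommRing S] (φ : R →+* S) (k : ℕ) :
    (derivSigmaSeries R k).map φ = derivSigmaSeries S k := by
  ext n; simp [derivSigmaSeries]

theorem qExpansion_E₄_eq :
    UpperHalfPlane.qExpansion 1 ModularForm.E₄ = 1 + C 240 * sigmaSeries ℂ 3 := by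
  ext m
  rw [EisensteinSeries.E_qExpansion_coeff _ ⟨2, rfl⟩, map_add, coeff_C_mul, coeff_one]
  rcases eq_or_ne m 0 with rfl | hm
  · simp [sigmaSeries]
  · norm_num [hm, sigmaSeries, show bernoulli 4 = -1 / 30 by decide +kernel]

theorem qExpansion_E₆_eq :
    UpperHalfPlane.qExpansion 1 ModularForm.E₆ = 1 + C (-504) * sigmaSeries ℂ 5 := by
  ext m
  rw [EisensteinSeries.E_qExpansion_coeff _ ⟨3, rfl⟩, map_add, coeff_C_mul, coeff_one]
  rcases eq_or_ne m 0 with rfl | hm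
  · simp [sigmaSeries]
  · norm_num [hm, sigmaSeries, show bernoulli 6 = 1 / 42 by decide +kernel]

theorem mk_mul_coeff_one_add_C_mul_sigmaSeries {R : Type*} [CommRing R] (c : R) (k : ℕ) :
    (.mk fun m ↦ (m : R) * (1 + C c * sigmaSeries R k).coeff m : R⟦X⟧) =
      C c * derivSigmaSeries R k := by
  ext m
  rw [coeff_mk, map_add, coeff_C_mul, coeff_C_mul, coeff_one]
  rcases eq_or_ne m 0 with rfl | hm
  · simp [derivSigmaSeries]
  · simp only [hm, sigmaSeries, derivSigmaSeries, coeff_mk, if_false]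
    ring

/-- The identity `2 E₄ θE₆ - 3 E₆ θE₄ = -1728 Δ` with integral coefficients. -/
theorem sigmaSeries_bracket_eq :
    2 * (1 + 240 * sigmaSeries ℤ 3) * (-504 * derivSigmaSeries ℤ 5) -
      3 * (1 - 504 * sigmaSeries ℤ 5) * (240 * derivSigmaSeries ℤ 3) =
      -1728 * (X * pentagonalSeries ℤ ^ 24) := by
  apply map_injective (Int.castRingHom ℂ) Int.cast_injective
  have h := qExpansion_bracketE₄E₆_eq_smul_discriminant
  rw [qExpansion_bracketE₄E₆, qExpansion_discriminant, qExpansion_E₄_eq, qExpansion_E₆_eq,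
    mk_mul_coeff_one_add_C_mul_sigmaSeries, mk_mul_coeff_one_add_C_mul_sigmaSeries,
    smul_eq_C_mul] at h
  simp only [map_neg, map_ofNat] at h
  simp only [map_sub, map_mul, map_add, map_neg, map_pow, map_one, map_ofNat, map_sigmaSeries,
    map_derivSigmaSeries, map_pentagonalSeries, map_X]
  linear_combination h

theorem natCast_sigma_prime (p : ℕ) [Fact p.Prime] (m : ℕ) : (σ p m : ZMod p) = σ 1 m := by
  simp [ArithmeticFunction.sigma_apply, ZMod.pow_card]

theorem X_mul_pentagonalSeries_pow_eq :
    X * pentagonalSeries (ZMod 5) ^ 24 = derivSigmaSeries (ZMod 5) 5 := by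
  have h := congrArg (PowerSeries.map (Int.castRingHom (ZMod 5))) sigmaSeries_bracket_eq
  simp only [map_sub, map_mul, map_add, map_neg, map_pow, map_one, map_ofNat, map_sigmaSeries,
    map_derivSigmaSeries, map_pentagonalSeries, map_X] at h
  have h5 : (5 : (ZMod 5)⟦X⟧) = 0 := by
    rw [← map_ofNat (C (R := ZMod 5)) 5, show (OfNat.ofNat 5 : ZMod 5) = 0 from rfl, map_zero]
  -- Mod 5, `h` says 2θ-series = 2Δ, as 240 ≡ 0, -504 ≡ 1 and -1728 ≡ 2; the `h5` terms absorb the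
  -- multiples of 5.
  linear_combination 2 * h + h5 * (-691 * (X * pentagonalSeries (ZMod 5) ^ 24) +
    403 * derivSigmaSeries (ZMod 5) 5 +
    96768 * sigmaSeries (ZMod 5) 3 * derivSigmaSeries (ZMod 5) 5 +
    288 * derivSigmaSeries (ZMod 5) 3 -
    145152 * sigmaSeries (ZMod 5) 5 * derivSigmaSeries (ZMod 5) 3)

theorem natCast_card_restricted_twentyFive (n : ℕ) :
    ((Nat.Partition.restricted n (fun i => ¬ 25 ∣ i)).card : ZMod 5) =
      (n + 1 : ℕ) * σ 1 (n + 1) := by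
  have : Fact (Nat.Prime 5) := ⟨by norm_num⟩
  have h := mk_card_restricted_eq_pentagonalSeries_pow 5 2
  norm_num only at h
  have := congrArg (coeff (n + 1)) X_mul_pentagonalSeries_pow_eq
  rw [← h, coeff_succ_X_mul, coeff_mk] at this
  rw [this, derivSigmaSeries, coeff_mk, natCast_sigma_prime]

theorem natCast_regularPartitionCount_twentyFive (N : ℕ) :
    (regularPartitionCount 25 ((N : ℤ) - 1) : ZMod 5) = N * σ 1 N := by
  cases N with
  | zero => simp [regularPartitionCount]
  | succ n => simp [regularPartitionCount, natCast_card_restricted_twentyFive]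

end TauCongruence

/-! ### Divisibility along the progression -/

theorem theorem1p4 (α n : ℕ) (p : Fin (α + 1) → ℕ) (hp : ∀ i, (p i).Prime)
    (hb : ∀ i, regularPartitionCount 25 ((p i : ℤ) - 1) ≡ 0 [MOD 5])
    (j : ℤ) (hj : ¬ j ≡ 0 [ZMOD (p (Fin.last α) : ℤ)]) :
    regularPartitionCount 25
        ((∏ i : Fin (α + 1), (p i : ℤ) ^ 2) * (n : ℤ)
          + (∏ i : Fin α, (p i.castSucc : ℤ) ^ 2) * (p (Fin.last α) : ℤ)
            * (j + (p (Fin.last α) : ℤ)) - 1) ≡ 0 [MOD 5] := by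
  set q := p (Fin.last α) with hq
  have hqp : q.Prime := hp _
  set P := ∏ i : Fin α, p i.castSucc with hP
  have hP0 : P ≠ 0 := Finset.prod_ne_zero_iff.mpr fun i _ ↦ (hp _).ne_zero
  set M : ℤ := q * n + j + q with hM
  have hqM : ¬ (q : ℤ) ∣ M := fun h ↦ hj <| Int.modEq_zero_iff_dvd.mpr <| by
    have : j = M - q * (n + 1) := by rw [hM]; ring
    rw [this]
    exact dvd_sub h (dvd_mul_right _ _)
  have harg : (∏ i : Fin (α + 1), (p i : ℤ) ^ 2) * (n : ℤ)
      + (∏ i : Fin α, (p i.castSucc : ℤ) ^ 2) * (q : ℤ) * (j + (q : ℤ)) =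
      ((P ^ 2 * q : ℕ) : ℤ) * M := by
    rw [Fin.prod_univ_castSucc, Finset.prod_pow, ← hq, hP, hM]
    push_cast
    ring
  rw [harg]
  -- As `j` may be negative, so may the argument; the count is then 0 by convention.
  rcases le_or_gt M 0 with hM0 | hM0
  · have : ¬ 0 ≤ ((P ^ 2 * q : ℕ) : ℤ) * M - 1 := by
      have := mul_nonpos_of_nonneg_of_nonpos (Int.natCast_nonneg (P ^ 2 * q)) hM0
      linarith
    rw [regularPartitionCount, if_neg this]
  lift M to ℕ using hM0.le with m
  have hm0 : m ≠ 0 := by rintro rfl; simp at hM0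
  have hqm : ¬ q ∣ m := fun h ↦ hqM (by exact_mod_cast h)
  have hbq := hb (Fin.last α)
  rw [← hq] at hbq
  rw [← ZMod.natCast_eq_natCast_iff, Nat.cast_zero] at hbq ⊢
  rw [natCast_regularPartitionCount_twentyFive] at hbq
  rw [← Nat.cast_mul, natCast_regularPartitionCount_twentyFive]
  have : Fact (Nat.Prime 5) := ⟨by norm_num⟩
  -- Either 5 ∣ q, and 5 divides the factor N, or 5 ∣ q + 1, and 5 divides σ(N).
  rcases mul_eq_zero.mp hbq with h | h
  · push_cast
    rw [h]
    ring
  · have hσ : ArithmeticFunction.sigma 1 q = q + 1 := by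
      simpa [Finset.sum_range_succ, add_comm] using
        ArithmeticFunction.sigma_one_apply_prime_pow (i := 1) hqp
    -- `P ^ 2` contributes an even exponent even when `q` is among the earlier primes.
    have hodd : Odd ((P ^ 2 * q * m).factorization q) := by
      rw [Nat.factorization_mul (by simp [hP0, hqp.ne_zero]) hm0,
        Nat.factorization_mul (by simp [hP0]) hqp.ne_zero, Nat.factorization_pow]
      simp [hqp.factorization_self, Nat.factorization_eq_zero_of_not_dvd hqm]
    obtain ⟨c, hc⟩ := add_one_dvd_sigma_one_of_odd_factorization hqp
      (by simp [hP0, hqp.ne_zero, hm0]) hodd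
    rw [hc, ← hσ, Nat.cast_mul (ArithmeticFunction.sigma 1 q), h]
    simp
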